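/- Let $n$ be a natural number and let $u:\mathbb R^n\to\mathbb R$ be a smooth ($C^\infty$) function satisfying $$\sum_{i=1}^n\arctan\lambda_i(x)=\tfrac12\,x\cdot Du(x)-u(x)\qquad\text{for all }x\in\mathbb R^n,$$ where $\lambda_1(x),\dots,\lambda_n(x)$ are the eigenvalues, counted with multiplicity, of the Hessian matrix $D^2u(x)$. Then $u$ is the quadratic polynomial $$u(x)=u(0)+\tfrac12\langle D^2u(0)x,x\rangle\qquad\text{for all }x\in\mathbb R^n.$$ -/

import Mathlib

open scoped ContDiff

/-- The Hessian matrix `D²u(x) = (∂ᵢ∂ⱼu(x))` of a function `u` on `ℝⁿ`. -/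
noncomputable def hessianMatrix {n : ℕ} (u : EuclideanSpace ℝ (Fin n) → ℝ)
    (x : EuclideanSpace ℝ (Fin n)) : Matrix (Fin n) (Fin n) ℝ :=
  Matrix.of fun i j =>
    fderiv ℝ (fderiv ℝ u) x (EuclideanSpace.single i 1) (EuclideanSpace.single j 1)

/-- The Hessian matrix of a smooth function is symmetric. -/
theorem isHermitian_hessianMatrix {n : ℕ} {u : EuclideanSpace ℝ (Fin n) → ℝ}
    (hu : ContDiff ℝ ∞ u) (x : EuclideanSpace ℝ (Fin n)) : (hessianMatrix u x).IsHermitian := by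
  refine Matrix.IsHermitian.ext fun i j => ?_
  have h : IsSymmSndFDerivAt ℝ u x :=
    (hu.contDiffAt (x := x)).isSymmSndFDerivAt (by simpa using WithTop.coe_le_coe.2 (le_top : (2 : ℕ∞) ≤ ⊤))
  simpa [hessianMatrix] using h.eq (EuclideanSpace.single j 1) (EuclideanSpace.single i 1)

/-- The phase `Θ(x) = arctan λ₁(x) + ⋯ + arctan λₙ(x)` of a smooth function `u` on `ℝⁿ`, where
`λ₁(x), …, λₙ(x)` are the eigenvalues of `D²u(x)`, listed with multiplicity. -/
noncomputable def phase {n : ℕ} {u : EuclideanSpace ℝ (Fin n) → ℝ}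
    (hu : ContDiff ℝ ∞ u) (x : EuclideanSpace ℝ (Fin n)) : ℝ :=
  ∑ i, Real.arctan ((isHermitian_hessianMatrix hu x).eigenvalues i)

/-! The phase Θ satisfies a linear elliptic equation without zeroth-order term. Since Θ is the
argument of det(1 + i D²u), DΘ(y) = Σ (1 + λᵢ²)⁻¹ D³u(y, eᵢ, eᵢ) in an eigenbasis eᵢ of D²u(x)
(`fderiv_phase_apply`); eigenvalues may lose smoothness where they cross, but Θ equals ½ x·Du − u
and so is smooth. Differentiating that potential twice gives D²Θ(x) = ½ D³u(x)(x)
(`fderiv_fderiv_shrinkerPotential`). Taking the weighted trace, Σ (1 + λᵢ²)⁻¹ D²Θ(eᵢ, eᵢ) = ½ DΘ(x).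

As Θ ≤ nπ/2, the Liouville theorem `eq_of_driftOp_eq_zero` makes Θ constant: the drift −½ x·D
confines the search for a maximum to a fixed ball, and the strong maximum principle does the rest. A
constant potential means D²u(x)x = Du(x) and D³u(x)x = 0, so D²u is constant along rays and u is
quadratic. -/

/-! ### Differentiating the argument of det(1 + iB). -/

/-- The derivative of the determinant along a curve of matrices passing through a diagonal matrix. -/
theorem hasDerivAt_det_of_eq_diagonal {ι : Type*} [Fintype ι] [DecidableEq ι]
    {M : ℝ → Matrix ι ι ℂ} {M' : Matrix ι ι ℂ} {d : ι → ℂ} {t₀ : ℝ}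
    (hM : ∀ i j, HasDerivAt (fun t => M t i j) (M' i j) t₀) (hd : M t₀ = Matrix.diagonal d) :
    HasDerivAt (fun t => (M t).det) (∑ i, (∏ j ∈ Finset.univ.erase i, d j) * M' i i) t₀ := by
  have key : HasDerivAt (fun t => (M t).det)
      (∑ σ : Equiv.Perm ι, ((Equiv.Perm.sign σ : ℤ) : ℂ) *
        ∑ i, (∏ j ∈ Finset.univ.erase i, M t₀ (σ j) j) * M' (σ i) i) t₀ := by
    simp only [Matrix.det_apply']
    refine HasDerivAt.fun_sum fun σ _ => HasDerivAt.const_mul _ ?_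
    simpa [smul_eq_mul] using HasDerivAt.fun_finsetProd (u := Finset.univ)
      (f := fun i t => M t (σ i) i) (f' := fun i => M' (σ i) i) (x := t₀) fun i _ => hM (σ i) i
  convert key using 1
  -- A nontrivial permutation moves at least two indices, so an off-diagonal zero survives the
  -- removal of any one factor.
  rw [Finset.sum_eq_single (1 : Equiv.Perm ι)]
  · simp [hd]
  · intro σ _ hσ
    refine mul_eq_zero_of_right _ (Finset.sum_eq_zero fun i _ => mul_eq_zero_of_left ?_ _)
    obtain ⟨k, hk⟩ : ∃ k, σ k ≠ k := by
      by_contra! h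
      exact hσ (Equiv.ext h)
    obtain ⟨j, hji, hj⟩ : ∃ j, j ≠ i ∧ σ j ≠ j := by
      by_cases hki : k = i
      · exact ⟨σ k, hki ▸ hk, fun h => hk (σ.injective h)⟩
      · exact ⟨k, hki, hk⟩
    refine Finset.prod_eq_zero (Finset.mem_erase.2 ⟨hji, Finset.mem_univ j⟩) ?_
    rw [hd, Matrix.diagonal_apply_ne _ hj]
  · simp

theorem one_add_mul_I_eq (t : ℝ) :
    (1 : ℂ) + Complex.I * t = (Real.sqrt (1 + t ^ 2) : ℂ) * Complex.exp (Complex.I * Real.arctan t) := by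
  have h : Real.sqrt (1 + t ^ 2) ≠ 0 := by positivity
  rw [mul_comm Complex.I (Real.arctan t : ℂ), Complex.exp_mul_I, ← Complex.ofReal_cos,
    ← Complex.ofReal_sin, Real.cos_arctan, Real.sin_arctan]
  apply Complex.ext <;> simp <;> field_simp

/-- If `B` has eigenvalues `l i`, then `det (1 + i B)` has argument `∑ i, arctan (l i)`. -/
theorem det_one_add_I_smul {ι : Type*} [Fintype ι] [DecidableEq ι] {B : Matrix ι ι ℝ} {l : ι → ℝ}
    (hB : B.charpoly = ∏ i, (Polynomial.X - Polynomial.C (l i))) :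
    (1 + Complex.I • B.map Complex.ofReal).det =
      ((∏ i, Real.sqrt (1 + l i ^ 2) : ℝ) : ℂ) *
        Complex.exp (Complex.I * ((∑ i, Real.arctan (l i) : ℝ) : ℂ)) := by
  have h1 : (B.map Complex.ofReal).charpoly =
      ∏ i, (Polynomial.X - Polynomial.C (l i : ℂ)) := by
    have := Matrix.charpoly_map B Complex.ofRealHom
    rw [hB, Polynomial.map_prod] at this
    rw [show (Complex.ofReal : ℝ → ℂ) = Complex.ofRealHom from rfl, this]
    simp
  -- Up to a power of −i, the determinant is the characteristic polynomial evaluated at i.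
  have h2 : (1 + Complex.I • B.map Complex.ofReal) =
      (-Complex.I) • (Matrix.scalar ι Complex.I - B.map Complex.ofReal) := by
    rw [smul_sub, sub_eq_add_neg, ← neg_smul, neg_neg]
    congr 1
    ext i j
    by_cases h : i = j <;> simp [Matrix.one_apply, h]
  rw [h2, Matrix.det_smul, ← Matrix.eval_charpoly, h1, Polynomial.eval_prod,
    ← Finset.card_univ, ← Finset.prod_const, ← Finset.prod_mul_distrib]
  push_cast
  rw [Finset.mul_sum, Complex.exp_sum, ← Finset.prod_mul_distrib]
  refine Finset.prod_congr rfl fun i _ => ?_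
  have := one_add_mul_I_eq (l i)
  push_cast at this
  rw [← this]
  simp [mul_sub]

/-- The derivative of `∑ i, arctan (l i)`, for the eigenvalues `l i` of a curve of matrices,
at a time where the matrix is diagonal. -/
theorem deriv_sum_arctan_eigenvalues {ι : Type*} [Fintype ι] [DecidableEq ι]
    {B : ℝ → Matrix ι ι ℝ} {B' : Matrix ι ι ℝ} {l : ℝ → ι → ℝ} {m : ι → ℝ} {t₀ a : ℝ}
    (hB : ∀ i j, HasDerivAt (fun t => B t i j) (B' i j) t₀)
    (hl : ∀ t, (B t).charpoly = ∏ i, (Polynomial.X - Polynomial.C (l t i)))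
    (hm : B t₀ = Matrix.diagonal m)
    (ha : HasDerivAt (fun t => ∑ i, Real.arctan (l t i)) a t₀) :
    a = ∑ i, (1 + m i ^ 2)⁻¹ * B' i i := by
  set θ : ℝ → ℝ := fun t => ∑ i, Real.arctan (l t i) with hθ
  set r : ℝ → ℝ := fun t => ∏ i, Real.sqrt (1 + l t i ^ 2) with hr
  set D : ℝ → ℂ := fun t => (1 + Complex.I • (B t).map Complex.ofReal).det with hD
  have hrpos : 0 < r t₀ := Finset.prod_pos fun i _ => by positivity
  -- Rotating by −θ makes the determinant real, so the derivative of its imaginary part vanishes.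
  -- This determines a without differentiating any single eigenvalue.
  have hDr : ∀ t, D t * Complex.exp (-(Complex.I * θ t)) = r t := fun t => by
    simp only [hD, det_one_add_I_smul (hl t)]
    rw [mul_assoc, ← Complex.exp_add]
    simp [hr, hθ]
  have hne : ∀ i, (1 : ℂ) + Complex.I * m i ≠ 0 := fun i h => by
    simpa using congrArg Complex.re h
  have hdiag : 1 + Complex.I • (B t₀).map Complex.ofReal =
      Matrix.diagonal fun i => 1 + Complex.I * (m i : ℂ) := by
    rw [hm]
    ext i j
    by_cases h : i = j <;> simp [h]
  have hD0 : D t₀ = ∏ i, (1 + Complex.I * (m i : ℂ)) := by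
    simp only [hD, hdiag, Matrix.det_diagonal]
  have hD' : HasDerivAt D (D t₀ * ∑ i, (1 + Complex.I * (m i : ℂ))⁻¹ * (Complex.I * B' i i)) t₀ := by
    have := hasDerivAt_det_of_eq_diagonal (M := fun t => 1 + Complex.I • (B t).map Complex.ofReal)
      (M' := Complex.I • B'.map Complex.ofReal) (t₀ := t₀) (fun i j => by
        simpa using (((hB i j).ofReal_comp).const_mul Complex.I).const_add
          ((1 : Matrix ι ι ℂ) i j)) hdiag
    convert this using 1
    rw [hD0, Finset.mul_sum]
    refine Finset.sum_congr rfl fun i _ => ?_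
    rw [← Finset.mul_prod_erase _ _ (Finset.mem_univ i)]
    have := hne i
    simp only [Matrix.smul_apply, Matrix.map_apply, smul_eq_mul]
    field_simp
  have hE : HasDerivAt (fun t => Complex.exp (-(Complex.I * θ t)))
      (Complex.exp (-(Complex.I * θ t₀)) * (-(Complex.I * a))) t₀ :=
    ((ha.ofReal_comp.const_mul Complex.I).neg).cexp
  have hF := hD'.mul hE
  have hF' : HasDerivAt (fun t => ((D t * Complex.exp (-(Complex.I * θ t))).im))
      (r t₀ * ((∑ i, (1 + Complex.I * (m i : ℂ))⁻¹ * (Complex.I * B' i i)) - Complex.I * a)).im t₀ := by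
    have := Complex.imCLM.hasFDerivAt.comp_hasDerivAt t₀ hF
    refine this.congr_deriv ?_
    rw [← hDr t₀, Complex.imCLM_apply]
    congr 1
    ring
  have h0 : HasDerivAt (fun t => ((D t * Complex.exp (-(Complex.I * θ t))).im)) 0 t₀ := by
    simp only [hDr, Complex.ofReal_im]
    exact hasDerivAt_const _ _
  have h1 := hF'.unique h0
  rw [Complex.im_ofReal_mul] at h1
  have h2 := (mul_eq_zero.1 h1).resolve_left hrpos.ne'
  have h3 : ∀ i, ((1 + Complex.I * (m i : ℂ))⁻¹ * (Complex.I * B' i i)).im =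
      (1 + m i ^ 2)⁻¹ * B' i i := fun i => by
    have hn : Complex.normSq (1 + Complex.I * (m i : ℂ)) = 1 + m i ^ 2 := by
      simp [Complex.normSq_apply, sq]
    simp [Complex.mul_im, Complex.inv_re, Complex.inv_im, hn]
  rw [Complex.sub_im, Complex.im_sum] at h2
  simp only [h3] at h2
  simp at h2
  linarith

theorem ContDiff.hasFDerivAt_fderiv {E : Type*} [NormedAddCommGroup E] [NormedSpace ℝ E]
    {f : E → ℝ} (hf : ContDiff ℝ 2 f) (x : E) :
    HasFDerivAt (fderiv ℝ f) (fderiv ℝ (fderiv ℝ f) x) x :=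
  ((hf.fderiv_right (m := 1) (by norm_num)).differentiable (by norm_num) x).hasFDerivAt

theorem HasFDerivAt.hasDerivAt_add_smul {E F : Type*} [NormedAddCommGroup E] [NormedSpace ℝ E]
    [NormedAddCommGroup F] [NormedSpace ℝ F] {f : E → F} {f' : E →L[ℝ] F} {x y : E} {t : ℝ}
    (hf : HasFDerivAt f f' (x + t • y)) : HasDerivAt (fun t : ℝ => f (x + t • y)) (f' y) t :=
  hf.comp_hasDerivAt t (by simpa using ((hasDerivAt_id t).smul_const y).const_add x)

/-! ### Maximum principles and a Liouville theorem for the drift operator. -/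

section MaximumPrinciple

variable {E : Type*} [NormedAddCommGroup E] [InnerProductSpace ℝ E] {ι : Type*} [Fintype ι]

/-- The second derivative is negative semidefinite at a local maximum. -/
theorem IsLocalMax.fderiv_fderiv_apply_self_nonpos {f : E → ℝ} {x : E} (h : IsLocalMax f x)
    (hf : ContDiff ℝ 2 f) (w : E) : fderiv ℝ (fderiv ℝ f) x w w ≤ 0 := by
  have hline : ∀ t : ℝ, HasDerivAt (fun t : ℝ => x + t • w) w t := fun t => by
    simpa using ((hasDerivAt_id t).smul_const w).const_add x
  set g : ℝ → ℝ := fun t => f (x + t • w) with hg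
  have hg' : ∀ t, HasDerivAt g (fderiv ℝ f (x + t • w) w) t := fun t =>
    ((hf.differentiable (by norm_num) _).hasFDerivAt).comp_hasDerivAt t (hline t)
  have hdg : deriv g = fun t => fderiv ℝ f (x + t • w) w := funext fun t => (hg' t).deriv
  have hg'' : deriv (deriv g) 0 = fderiv ℝ (fderiv ℝ f) x w w := by
    rw [hdg]
    have h1 : HasFDerivAt (fderiv ℝ f) (fderiv ℝ (fderiv ℝ f) x) (x + (0 : ℝ) • w) := by
      simpa using hf.hasFDerivAt_fderiv x
    have h2 : HasDerivAt (fun t : ℝ => fderiv ℝ f (x + t • w)) (fderiv ℝ (fderiv ℝ f) x w) 0 :=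
      h1.comp_hasDerivAt (0 : ℝ) (hline 0)
    refine HasDerivAt.deriv ?_
    refine (h2.clm_apply (hasDerivAt_const (0 : ℝ) w)).congr_deriv ?_
    rw [map_zero, add_zero]
  have hmax : IsLocalMax g 0 := by
    have hc : ContinuousAt (fun t : ℝ => x + t • w) 0 := (hline 0).continuousAt
    have hx : Filter.Tendsto (fun t : ℝ => x + t • w) (nhds 0) (nhds x) := by
      simpa [ContinuousAt] using hc
    filter_upwards [hx.eventually h] with t ht
    simpa [hg] using ht
  by_contra! hpos
  -- A positive second derivative would make 0 a local minimum as well, hence g locally constant.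
  have hmin : IsLocalMin g 0 :=
    isLocalMin_of_deriv_deriv_pos (hg''.symm ▸ hpos) hmax.deriv_eq_zero (hg' 0).continuousAt
  have hconst : g =ᶠ[nhds 0] fun _ => g 0 := by
    filter_upwards [hmin, hmax] with t h1 h2 using le_antisymm h2 h1
  have h0 : deriv (deriv g) 0 = 0 := by
    rw [hconst.deriv.deriv_eq]
    simp
  linarith

/-- The drift operator `∑ i, c i • D²f (b i, b i) - ½ x · Df`, with frame `b` and weights `c`
depending on the point. -/
noncomputable def driftOp (b : E → OrthonormalBasis ι ℝ E) (c : E → ι → ℝ) (f : E → ℝ) (x : E) : ℝ :=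
  ∑ i, c x i * fderiv ℝ (fderiv ℝ f) x (b x i) (b x i) - (1 / 2) * fderiv ℝ f x x

variable {b : E → OrthonormalBasis ι ℝ E} {c : E → ι → ℝ}

theorem driftOp_add_const_mul {f h : E → ℝ} (hf : ContDiff ℝ 2 f) (hh : ContDiff ℝ 2 h) (a : ℝ)
    (x : E) : driftOp b c (fun y => f y + a * h y) x = driftOp b c f x + a * driftOp b c h x := by
  have h1 : fderiv ℝ (fun y => f y + a * h y) = fun y => fderiv ℝ f y + a • fderiv ℝ h y :=
    funext fun y => ((hf.differentiable (by norm_num) y).hasFDerivAt.add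
      ((hh.differentiable (by norm_num) y).hasFDerivAt.const_mul a)).fderiv
  have h2 : fderiv ℝ (fun y => fderiv ℝ f y + a • fderiv ℝ h y) x =
      fderiv ℝ (fderiv ℝ f) x + a • fderiv ℝ (fderiv ℝ h) x :=
    ((hf.hasFDerivAt_fderiv x).add ((hh.hasFDerivAt_fderiv x).const_smul a)).fderiv
  simp only [driftOp, h1, h2, add_apply, smul_apply, smul_eq_mul, mul_add,
    Finset.sum_add_distrib, mul_sub, Finset.mul_sum]
  rw [Finset.sum_congr rfl fun i _ => mul_left_comm (c x i) a _]
  ring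

theorem IsLocalMax.driftOp_nonpos {f : E → ℝ} {x : E} (h : IsLocalMax f x)
    (hf : ContDiff ℝ 2 f) (hc : ∀ i, 0 ≤ c x i) : driftOp b c f x ≤ 0 := by
  simp only [driftOp, h.fderiv_eq_zero]
  simpa using Finset.sum_nonpos fun i _ =>
    mul_nonpos_of_nonneg_of_nonpos (hc i) (h.fderiv_fderiv_apply_self_nonpos hf (b x i))

theorem hasFDerivAt_normSq_sub (y x : E) :
    HasFDerivAt (fun x => ‖x - y‖ ^ 2) ((2 : ℝ) • innerSL ℝ (x - y)) x := by
  refine ((hasFDerivAt_id x).sub_const y).norm_sq.congr_fderiv ?_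
  ext w
  simp [two_smul]

theorem contDiff_normSq_sub (y : E) : ContDiff ℝ 2 fun x : E => ‖x - y‖ ^ 2 :=
  (contDiff_id.sub contDiff_const).norm_sq ℝ

theorem hasFDerivAt_innerSL_sub (y x : E) :
    HasFDerivAt (fun x => innerSL ℝ (x - y)) (innerSL ℝ : E →L[ℝ] E →L[ℝ] ℝ) x :=
  (innerSL ℝ : E →L[ℝ] E →L[ℝ] ℝ).hasFDerivAt.comp x ((hasFDerivAt_id x).sub_const y)

theorem driftOp_normSq (x : E) :
    driftOp b c (fun x => ‖x‖ ^ 2) x = 2 * ∑ i, c x i - ‖x‖ ^ 2 := by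
  have h1 : fderiv ℝ (fun x : E => ‖x‖ ^ 2) = fun x => (2 : ℝ) • innerSL ℝ (x - 0) :=
    funext fun x => by simpa using (hasFDerivAt_normSq_sub 0 x).fderiv
  have h2 : fderiv ℝ (fun x : E => (2 : ℝ) • innerSL ℝ (x - 0)) x =
      (2 : ℝ) • (innerSL ℝ : E →L[ℝ] E →L[ℝ] ℝ) :=
    ((hasFDerivAt_innerSL_sub 0 x).const_smul (2 : ℝ)).fderiv
  have h3 : ∀ w : E, (innerSL ℝ : E →L[ℝ] E →L[ℝ] ℝ) w w = ‖w‖ ^ 2 := real_inner_self_eq_norm_sq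
  rw [driftOp, h1, h2]
  simp [h3, Finset.sum_mul, mul_comm]

theorem contDiff_exp_normSq_sub (α : ℝ) (y : E) :
    ContDiff ℝ 2 fun x : E => Real.exp (-α * ‖x - y‖ ^ 2) :=
  (contDiff_const.mul (contDiff_normSq_sub y)).exp

/-- Hopf's barrier: away from y, the term quadratic in α dominates once α is large. -/
theorem driftOp_exp_normSq_sub (α : ℝ) (y x : E) :
    driftOp b c (fun x => Real.exp (-α * ‖x - y‖ ^ 2)) x =
      Real.exp (-α * ‖x - y‖ ^ 2) * α *
        (4 * α * ∑ i, c x i * inner ℝ (x - y) (b x i) ^ 2 - 2 * ∑ i, c x i + inner ℝ (x - y) x) := by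
  set g : E → ℝ := fun x => Real.exp (-α * ‖x - y‖ ^ 2) with hg
  have hg' : ∀ x, HasFDerivAt g ((-2 * α * g x) • innerSL ℝ (x - y)) x := fun x => by
    refine (((hasFDerivAt_normSq_sub y x).const_mul (-α)).exp).congr_fderiv ?_
    simp only [smul_smul, hg]
    congr 1
    ring
  have h1 : fderiv ℝ g = fun x => (-2 * α * g x) • innerSL ℝ (x - y) :=
    funext fun x => (hg' x).fderiv
  have h2 := (((hg' x).const_mul (-2 * α)).smul (hasFDerivAt_innerSL_sub y x)).fderiv
  have h3 : ∀ w, fderiv ℝ (fun x => (-2 * α * g x) • innerSL ℝ (x - y)) x w w =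
      g x * α * (4 * α * inner ℝ (x - y) w ^ 2 - 2 * ‖w‖ ^ 2) := fun w => by
    refine (congrArg (fun L : E →L[ℝ] E →L[ℝ] ℝ => L w w) h2).trans ?_
    have h4 : (innerSL ℝ : E →L[ℝ] E →L[ℝ] ℝ) w w = ‖w‖ ^ 2 := real_inner_self_eq_norm_sq w
    simp only [add_apply, smul_apply, ContinuousLinearMap.smulRight_apply, smul_eq_mul,
      innerSL_apply_apply, h4]
    ring
  simp only [driftOp, h1, h3]
  simp only [(b x).norm_eq_one, smul_apply, innerSL_apply_apply, smul_eq_mul]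
  have h4 : ∀ i, c x i * (g x * α * (4 * α * inner ℝ (x - y) (b x i) ^ 2 - 2 * 1 ^ 2)) =
      g x * α * (4 * α * (c x i * inner ℝ (x - y) (b x i) ^ 2)) - g x * α * (2 * c x i) :=
    fun i => by ring
  simp only [h4, Finset.sum_sub_distrib, ← Finset.mul_sum]
  ring

variable [FiniteDimensional ℝ E]

/-- A function bounded above with `driftOp b c f = 0` attains its supremum. -/
theorem exists_forall_le_of_driftOp_eq_zero {f : E → ℝ} (hf : ContDiff ℝ 2 f) {C : ℝ}
    (hC : ∀ x, f x ≤ C) (hc0 : ∀ x i, 0 ≤ c x i) (hc1 : ∀ x i, c x i ≤ 1)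
    (h0 : ∀ x, driftOp b c f x = 0) : ∃ p, ∀ x, f x ≤ f p := by
  -- At a maximum z of f − ε‖x‖², the operator gives ‖z‖² ≤ 2 Σ cᵢ ≤ 2 card ι, a bound independent
  -- of ε.
  set R : ℝ := Real.sqrt (2 * Fintype.card ι) with hR
  obtain ⟨p, -, hp⟩ := (isCompact_closedBall (0 : E) R).exists_isMaxOn
    ⟨0, Metric.mem_closedBall_self (Real.sqrt_nonneg _)⟩ hf.continuous.continuousOn
  refine ⟨p, fun x => ?_⟩
  have key : ∀ ε : ℝ, 0 < ε → f x - ε * ‖x‖ ^ 2 ≤ f p := fun ε hε => by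
    have hq : ContDiff ℝ 2 fun x : E => ‖x‖ ^ 2 := contDiff_id.norm_sq ℝ
    have hv : ContDiff ℝ 2 fun x => f x + -ε * ‖x‖ ^ 2 := hf.add (contDiff_const.mul hq)
    have hlim : Filter.Tendsto (fun x => f x + -ε * ‖x‖ ^ 2) (Filter.cocompact E) Filter.atBot := by
      refine Filter.tendsto_atBot_mono
        (fun x => add_le_add_left (hC x) _) (Filter.tendsto_atBot_add_const_left _ _ ?_)
      exact ((Filter.tendsto_pow_atTop two_ne_zero).comp
        (tendsto_norm_cocompact_atTop (E := E))).const_mul_atTop_of_neg (by linarith)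
    obtain ⟨z, hz⟩ := hv.continuous.exists_forall_ge hlim
    have hzmax : IsLocalMax (fun x => f x + -ε * ‖x‖ ^ 2) z := Filter.Eventually.of_forall hz
    have h1 := hzmax.driftOp_nonpos (b := b) hv (hc0 z)
    rw [driftOp_add_const_mul hf hq, h0, driftOp_normSq] at h1
    have h2 : ∑ i, c z i ≤ Fintype.card ι :=
      (Finset.sum_le_sum fun i _ => hc1 z i).trans (by simp)
    have h3 : ‖z‖ ^ 2 ≤ 2 * Fintype.card ι := by nlinarith
    have h4 : f z ≤ f p := hp (by simpa [hR] using Real.le_sqrt_of_sq_le h3)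
    have h5 := hz x
    have h6 : 0 ≤ ε * ‖z‖ ^ 2 := by positivity
    linarith
  refine le_of_forall_pos_le_add fun ε hε => ?_
  have h1 := key (ε / (‖x‖ ^ 2 + 1)) (by positivity)
  have h2 : ε / (‖x‖ ^ 2 + 1) * ‖x‖ ^ 2 ≤ ε := by
    rw [div_mul_eq_mul_div, div_le_iff₀ (by positivity)]
    nlinarith
  linarith

/-- The strong maximum principle for `driftOp`. -/
theorem eq_of_forall_le_of_driftOp_eq_zero {f : E → ℝ} (hf : ContDiff ℝ 2 f)
    (hc : ∀ R : ℝ, ∃ δ > 0, ∀ x, ‖x‖ ≤ R → ∀ i, δ ≤ c x i) (hc1 : ∀ x i, c x i ≤ 1)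
    (h0 : ∀ x, driftOp b c f x = 0) {q : E} (hq : ∀ x, f x ≤ f q) (x : E) : f x = f q := by
  by_contra hx
  set K : Set E := {z | f z = f q} with hK
  have hKc : IsClosed K := isClosed_eq hf.continuous continuous_const
  obtain ⟨p, hpK, hp⟩ := hKc.exists_infDist_eq_dist ⟨q, rfl⟩ x
  -- The ball about the midpoint y with radius r lies in the ball about x of radius 2r = dist x p,
  -- and touches the contact set K only at p.
  have hpf : f p = f q := hpK
  set y : E := midpoint ℝ x p with hy
  set r : ℝ := dist x p / 2 with hr
  have hrpos : 0 < r := half_pos (dist_pos.2 fun h => hx (h ▸ hpK))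
  have hpy : ‖p - y‖ = r := by
    rw [← dist_eq_norm, hy, dist_right_midpoint]
    simp [hr, div_eq_inv_mul]
  have hpx : p - y = y - x := by
    rw [hy, right_sub_midpoint, midpoint_sub_left]
  have hlt : ∀ z, ‖z - y‖ ≤ r → z ≠ p → f z < f q := fun z hz hzp => by
    refine lt_of_le_of_ne (hq z) fun hzK => hzp ?_
    have h1 : 2 * r ≤ ‖(z - y) + (p - y)‖ := by
      rw [hpx, sub_add_sub_cancel, ← dist_eq_norm, dist_comm]
      have := Metric.infDist_le_dist_of_mem (x := x) (show z ∈ K from hzK)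
      linarith
    have h2 := parallelogram_law_with_norm ℝ (z - y) (p - y)
    rw [hpy, sub_sub_sub_cancel_right] at h2
    have h3 : ‖z - p‖ = 0 := by nlinarith [norm_nonneg (z - p), norm_nonneg (z - y)]
    exact sub_eq_zero.1 (norm_eq_zero.1 h3)
  obtain ⟨m, hm, hmS⟩ : ∃ m < f q, ∀ z ∈ Metric.sphere p (r / 2) ∩ Metric.closedBall y r, f z ≤ m := by
    rcases (Metric.sphere p (r / 2) ∩ Metric.closedBall y r).eq_empty_or_nonempty with he | hne
    · exact ⟨f q - 1, by linarith, fun z hz => by simp [he] at hz⟩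
    · obtain ⟨z, hz, hzm⟩ := ((isCompact_sphere p (r / 2)).inter_right
        Metric.isClosed_closedBall).exists_isMaxOn hne hf.continuous.continuousOn
      refine ⟨f z, hlt z (by simpa [dist_eq_norm] using hz.2) ?_, fun w hw => hzm hw⟩
      rintro rfl
      have := hz.1
      simp at this
      linarith
  obtain ⟨δ, hδ, hcδ⟩ := hc (‖p‖ + r)
  -- N bounds the terms of unknown sign in the barrier computation; α makes the elliptic term, at
  -- least αδr² where ‖z − y‖ ≥ r/2, exceed N.
  set N : ℝ := 2 * Fintype.card ι + 2 * r * (‖p‖ + r) with hN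
  have hN0 : 0 ≤ N := by positivity
  set α : ℝ := (N + 1) / (δ * r ^ 2) with hα
  have hα0 : 0 < α := by positivity
  have hαr : α * (δ * r ^ 2) = N + 1 := div_mul_cancel₀ _ (by positivity)
  set g : E → ℝ := fun x => Real.exp (-α * ‖x - y‖ ^ 2) with hg
  have hgC : ContDiff ℝ 2 g := contDiff_exp_normSq_sub α y
  set ε : ℝ := (f q - m) / 2 with hε
  have hε0 : 0 < ε := by linarith
  set v : E → ℝ := fun z => f z + ε * g z with hv
  have hvC : ContDiff ℝ 2 v := hf.add (contDiff_const.mul hgC)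
  -- Inside the ball about y, the gap f q − m = 2ε beats the perturbation; outside it, the barrier
  -- is smaller than at p. So v has an interior maximum near p, where its operator is both
  -- nonpositive and positive.
  have hsphere : ∀ z ∈ Metric.sphere p (r / 2), v z < v p := fun z hz => by
    have hgp : 0 < g p := Real.exp_pos _
    by_cases hzy : ‖z - y‖ ≤ r
    · have h1 : f z ≤ m := hmS z ⟨hz, by simpa [dist_eq_norm] using hzy⟩
      have h2 : g z ≤ 1 := Real.exp_le_one_iff.2 (by nlinarith [sq_nonneg ‖z - y‖])
      simp only [hv]
      nlinarith
    · have h1 : g z < g p := Real.exp_lt_exp.2 (by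
        rw [hpy]
        nlinarith [mul_pos hα0 (show 0 < ‖z - y‖ ^ 2 - r ^ 2 by nlinarith)])
      have h2 := hq z
      simp only [hv]
      nlinarith
  obtain ⟨z, hz, hzm⟩ := (isCompact_closedBall p (r / 2)).exists_isMaxOn
    ⟨p, Metric.mem_closedBall_self (by linarith)⟩ hvC.continuous.continuousOn
  have hzb : z ∈ Metric.ball p (r / 2) := by
    refine lt_of_le_of_ne (Metric.mem_closedBall.1 hz) fun h => ?_
    exact absurd (hzm (Metric.mem_closedBall_self (by linarith : 0 ≤ r / 2))) (not_le.2 (hsphere z h))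
  have hzmax : IsLocalMax v z :=
    hzm.isLocalMax (Filter.mem_of_superset (Metric.isOpen_ball.mem_nhds hzb) Metric.ball_subset_closedBall)
  have hzp : ‖z - p‖ < r / 2 := by simpa [dist_eq_norm] using hzb
  have hzR : ‖z‖ ≤ ‖p‖ + r := by
    have := norm_le_norm_add_norm_sub' z p
    linarith
  have hzy1 : r / 2 ≤ ‖z - y‖ := by
    have := norm_sub_le_norm_sub_add_norm_sub p z y
    rw [hpy, norm_sub_rev p z] at this
    linarith
  have hzy2 : ‖z - y‖ ≤ 2 * r := by
    have := norm_sub_le_norm_sub_add_norm_sub z p y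
    rw [hpy] at this
    linarith
  have h1 := hzmax.driftOp_nonpos (b := b) (c := c) hvC fun i => hδ.le.trans (hcδ z hzR i)
  rw [hv, driftOp_add_const_mul hf hgC, h0, hg, driftOp_exp_normSq_sub] at h1
  have h2 : δ * (r ^ 2 / 4) ≤ ∑ i, c z i * inner ℝ (z - y) (b z i) ^ 2 := by
    calc δ * (r ^ 2 / 4) ≤ δ * ‖z - y‖ ^ 2 := by gcongr; nlinarith
      _ = ∑ i, δ * inner ℝ (z - y) (b z i) ^ 2 := by
        rw [← (b z).sum_sq_inner_left (z - y), Finset.mul_sum]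
      _ ≤ _ := Finset.sum_le_sum fun i _ =>
        mul_le_mul_of_nonneg_right (hcδ z hzR i) (sq_nonneg _)
  have h3 : ∑ i, c z i ≤ Fintype.card ι :=
    (Finset.sum_le_sum fun i _ => hc1 z i).trans (by simp)
  have h4 : -(2 * r * (‖p‖ + r)) ≤ inner ℝ (z - y) z := by
    have h5 := neg_le_of_abs_le (abs_real_inner_le_norm (z - y) z)
    have h6 : ‖z - y‖ * ‖z‖ ≤ 2 * r * (‖p‖ + r) := by gcongr
    linarith
  have h7 : α * (δ * (r ^ 2 / 4)) ≤ α * ∑ i, c z i * inner ℝ (z - y) (b z i) ^ 2 :=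
    mul_le_mul_of_nonneg_left h2 hα0.le
  have h8 : 0 < 4 * α * ∑ i, c z i * inner ℝ (z - y) (b z i) ^ 2 - 2 * ∑ i, c z i +
      inner ℝ (z - y) z := by linarith
  have h9 := mul_pos hε0 (mul_pos (mul_pos (Real.exp_pos (-α * ‖z - y‖ ^ 2)) hα0) h8)
  linarith

/-- Liouville theorem: a function bounded above with `driftOp b c f = 0` is constant. -/
theorem eq_of_driftOp_eq_zero {f : E → ℝ} (hf : ContDiff ℝ 2 f) {C : ℝ} (hC : ∀ x, f x ≤ C)
    (hc : ∀ R : ℝ, ∃ δ > 0, ∀ x, ‖x‖ ≤ R → ∀ i, δ ≤ c x i) (hc1 : ∀ x i, c x i ≤ 1)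
    (h0 : ∀ x, driftOp b c f x = 0) (x y : E) : f x = f y := by
  have hc0 : ∀ x i, 0 ≤ c x i := fun x i => by
    obtain ⟨δ, hδ, h⟩ := hc ‖x‖
    exact hδ.le.trans (h x le_rfl i)
  obtain ⟨p, hp⟩ := exists_forall_le_of_driftOp_eq_zero hf hC hc0 hc1 h0
  rw [eq_of_forall_le_of_driftOp_eq_zero hf hc hc1 h0 hp x,
    eq_of_forall_le_of_driftOp_eq_zero hf hc hc1 h0 hp y]

end MaximumPrinciple

theorem two_le_contDiff_infty : (2 : WithTop ℕ∞) ≤ ∞ :=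
  WithTop.coe_le_coe.2 (le_top : (2 : ℕ∞) ≤ ⊤)

/-! ### Derivatives of the potential and the case where it is constant. -/

section ShrinkerPotential

variable {E : Type*} [NormedAddCommGroup E] [NormedSpace ℝ E] {u : E → ℝ}

theorem ContDiff.hasFDerivAt_fderiv_fderiv (hu : ContDiff ℝ ∞ u) (x : E) :
    HasFDerivAt (fderiv ℝ (fderiv ℝ u)) (fderiv ℝ (fderiv ℝ (fderiv ℝ u)) x) x :=
  ((((hu.fderiv_right (m := ∞) (by norm_num)).fderiv_right (m := ∞) (by norm_num)).differentiable
    (by norm_num)) x).hasFDerivAt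

theorem fderiv_fderiv_comm (hu : ContDiff ℝ ∞ u) (x v w : E) :
    fderiv ℝ (fderiv ℝ u) x v w = fderiv ℝ (fderiv ℝ u) x w v :=
  (hu.contDiffAt.isSymmSndFDerivAt (by simpa using two_le_contDiff_infty)).eq v w

theorem fderiv_fderiv_fderiv_comm (hu : ContDiff ℝ ∞ u) (x v w : E) :
    fderiv ℝ (fderiv ℝ (fderiv ℝ u)) x v w = fderiv ℝ (fderiv ℝ (fderiv ℝ u)) x w v :=
  ((hu.fderiv_right (m := ∞) (by norm_num)).contDiffAt.isSymmSndFDerivAt (by simpa using two_le_contDiff_infty)).eq v w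

/-- The first derivative of the self-shrinker potential `½ x · Du - u`. -/
theorem fderiv_shrinkerPotential (hu : ContDiff ℝ ∞ u) :
    fderiv ℝ (fun x => (1 / 2) * fderiv ℝ u x x - u x) =
      fun x => (1 / 2 : ℝ) • (fderiv ℝ (fderiv ℝ u) x x - fderiv ℝ u x) := by
  have hu2 : ContDiff ℝ 2 u := hu.of_le two_le_contDiff_infty
  ext x w
  have h1 : HasFDerivAt u (fderiv ℝ u x) x := (hu.differentiable (by norm_num) x).hasFDerivAt
  have h2 := (((hu2.hasFDerivAt_fderiv x).clm_apply (hasFDerivAt_id x)).const_mul (1 / 2)).sub h1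
  refine (congrArg (fun L : E →L[ℝ] ℝ => L w) h2.fderiv).trans ?_
  simp [fderiv_fderiv_comm hu x w x]
  ring

/-- The second derivative of the self-shrinker potential `½ x · Du - u`. -/
theorem fderiv_fderiv_shrinkerPotential (hu : ContDiff ℝ ∞ u) (x : E) :
    fderiv ℝ (fderiv ℝ (fun x => (1 / 2) * fderiv ℝ u x x - u x)) x =
      (1 / 2 : ℝ) • fderiv ℝ (fderiv ℝ (fderiv ℝ u)) x x := by
  have hu2 : ContDiff ℝ 2 u := hu.of_le two_le_contDiff_infty
  rw [fderiv_shrinkerPotential hu]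
  ext w v
  have h2 := ((((hu.hasFDerivAt_fderiv_fderiv x).clm_apply (hasFDerivAt_id x)).sub
    (hu2.hasFDerivAt_fderiv x)).const_smul (1 / 2 : ℝ))
  refine (congrArg (fun L : E →L[ℝ] E →L[ℝ] ℝ =>
    L w v) h2.fderiv).trans ?_
  simp [fderiv_fderiv_fderiv_comm hu x w x]

/-- If `D³u(y) y = 0` for all `y`, then the Hessian is constant along rays. -/
theorem fderiv_fderiv_eq_of_radial_eq_zero (hu : ContDiff ℝ ∞ u)
    (h : ∀ y, fderiv ℝ (fderiv ℝ (fderiv ℝ u)) y y = 0) (x v w : E) :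
    fderiv ℝ (fderiv ℝ u) x v w = fderiv ℝ (fderiv ℝ u) 0 v w := by
  have hg : ∀ t : ℝ, HasDerivAt (fun t : ℝ => fderiv ℝ (fderiv ℝ u) (0 + t • x) v w)
      (fderiv ℝ (fderiv ℝ (fderiv ℝ u)) (0 + t • x) x v w) t := fun t => by
    have h1 := HasFDerivAt.hasDerivAt_add_smul (E := E) (F := E →L[ℝ] E →L[ℝ] ℝ)
      (hu.hasFDerivAt_fderiv_fderiv (0 + t • x))
    have h2 := h1.clm_apply (hasDerivAt_const t v)
    refine (h2.clm_apply (hasDerivAt_const t w)).congr_deriv ?_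
    simp
  have hcont : Continuous fun t : ℝ => fderiv ℝ (fderiv ℝ (fderiv ℝ u)) (0 + t • x) := by
    have h3 : Continuous (fderiv ℝ (fderiv ℝ (fderiv ℝ u))) :=
      ((hu.fderiv_right (m := ∞) (by norm_num)).fderiv_right (m := ∞) (by norm_num)).continuous_fderiv
        (by norm_num)
    exact h3.comp (continuous_const.add (continuous_id.smul continuous_const))
  have hcont' : Continuous fun t : ℝ => fderiv ℝ (fderiv ℝ (fderiv ℝ u)) (0 + t • x) x v w :=
    ((hcont.clm_apply continuous_const).clm_apply continuous_const).clm_apply continuous_const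
  -- The hypothesis at tx carries a factor t; continuity recovers t = 0.
  have hzero : (fun t : ℝ => fderiv ℝ (fderiv ℝ (fderiv ℝ u)) (0 + t • x) x v w) = fun _ => 0 := by
    refine hcont'.ext_on (dense_compl_singleton 0) continuous_const fun t ht => ?_
    have h1 := h (0 + t • x)
    rw [zero_add, map_smul, smul_eq_zero] at h1
    simp [h1.resolve_left ht]
  have h3 := is_const_of_deriv_eq_zero (fun t => (hg t).differentiableAt)
    (fun t => (hg t).deriv.trans (congrFun hzero t)) 1 0
  simpa using h3

/-- If the self-shrinker potential of `u` is constant, then `u - u 0` is a quadratic form. -/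
theorem eq_quadratic_of_shrinkerPotential_const (hu : ContDiff ℝ ∞ u) {c : ℝ}
    (hc : ∀ x, (1 / 2) * fderiv ℝ u x x - u x = c) (x : E) :
    u x = u 0 + (1 / 2) * fderiv ℝ (fderiv ℝ u) 0 x x := by
  have hfun : (fun x => (1 / 2) * fderiv ℝ u x x - u x) = fun _ => c := funext hc
  have hfun' : fderiv ℝ (fun x => (1 / 2) * fderiv ℝ u x x - u x) = fun _ => 0 := by
    rw [hfun]
    exact funext fun y => fderiv_const_apply c
  have h1 : fderiv ℝ (fderiv ℝ u) x x = fderiv ℝ u x := by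
    have := congrFun (fderiv_shrinkerPotential hu) x
    rw [hfun', eq_comm, smul_eq_zero] at this
    exact sub_eq_zero.1 (this.resolve_left (by norm_num))
  have h2 : ∀ y, fderiv ℝ (fderiv ℝ (fderiv ℝ u)) y y = 0 := fun y => by
    have := fderiv_fderiv_shrinkerPotential hu y
    rw [hfun', fderiv_const_apply, eq_comm, smul_eq_zero] at this
    exact this.resolve_left (by norm_num)
  have h4 := hc x
  have h5 := hc 0
  rw [← h1, fderiv_fderiv_eq_of_radial_eq_zero hu h2] at h4
  rw [map_zero] at h5
  linarith

end ShrinkerPotential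

/-! ### Hessian eigenbases and the derivative of the phase. -/

section Hessian

variable {n : ℕ}

theorem EuclideanSpace.clm_apply_apply_eq_dotProduct
    (L : EuclideanSpace ℝ (Fin n) →L[ℝ] EuclideanSpace ℝ (Fin n) →L[ℝ] ℝ)
    (v w : EuclideanSpace ℝ (Fin n)) :
    L v w = dotProduct v ((Matrix.of fun i j =>
      L (EuclideanSpace.single i 1) (EuclideanSpace.single j 1)).mulVec w) := by
  have hv : ∀ v : EuclideanSpace ℝ (Fin n), ∑ i, v i • EuclideanSpace.single i (1 : ℝ) = v :=
    fun v => by simpa using (EuclideanSpace.basisFun (Fin n) ℝ).sum_repr v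
  conv_lhs => rw [← hv v, ← hv w]
  simp only [map_sum, map_smul, sum_apply, smul_apply, smul_eq_mul, dotProduct, Matrix.mulVec,
    Matrix.of_apply]
  simp only [Finset.mul_sum]
  rw [Finset.sum_comm]
  exact Finset.sum_congr rfl fun i _ => Finset.sum_congr rfl fun j _ => by ring

/-- The matrices of a bilinear form in two orthonormal bases have the same characteristic
polynomial. -/
theorem charpoly_of_orthonormalBasis
    (L : EuclideanSpace ℝ (Fin n) →L[ℝ] EuclideanSpace ℝ (Fin n) →L[ℝ] ℝ)
    (b : OrthonormalBasis (Fin n) ℝ (EuclideanSpace ℝ (Fin n))) :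
    (Matrix.of fun i j => L (b i) (b j)).charpoly =
      (Matrix.of fun i j => L (EuclideanSpace.single i 1) (EuclideanSpace.single j 1)).charpoly := by
  set A : Matrix (Fin n) (Fin n) ℝ :=
    Matrix.of fun i j => L (EuclideanSpace.single i 1) (EuclideanSpace.single j 1)
  set P : Matrix (Fin n) (Fin n) ℝ := Matrix.of fun i k => b i k
  have hP : P * P.transpose = 1 := by
    ext i j
    have := b.inner_eq_ite i j
    rw [EuclideanSpace.inner_eq_star_dotProduct] at this
    rw [Matrix.one_apply, ← this, dotProduct_comm]
    simp [P, Matrix.mul_apply, dotProduct]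
  have hB : (Matrix.of fun i j => L (b i) (b j)) = P * A * P.transpose := by
    ext i j
    rw [Matrix.of_apply, EuclideanSpace.clm_apply_apply_eq_dotProduct, Matrix.dotProduct_mulVec]
    rfl
  rw [hB, Matrix.charpoly_mul_comm, ← mul_assoc, mul_eq_one_comm.1 hP, one_mul]

variable {u : EuclideanSpace ℝ (Fin n) → ℝ}

theorem fderiv_fderiv_apply_eq_inner (x v w : EuclideanSpace ℝ (Fin n)) :
    fderiv ℝ (fderiv ℝ u) x v w = inner ℝ (Matrix.toEuclideanLin (hessianMatrix u x) w) v := by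
  rw [EuclideanSpace.clm_apply_apply_eq_dotProduct, EuclideanSpace.inner_eq_star_dotProduct]
  simp [hessianMatrix]

theorem fderiv_fderiv_eigenvectorBasis (hu : ContDiff ℝ ∞ u) (x : EuclideanSpace ℝ (Fin n))
    (i j : Fin n) :
    fderiv ℝ (fderiv ℝ u) x ((isHermitian_hessianMatrix hu x).eigenvectorBasis i)
      ((isHermitian_hessianMatrix hu x).eigenvectorBasis j) =
      Matrix.diagonal (isHermitian_hessianMatrix hu x).eigenvalues i j := by
  set hA := isHermitian_hessianMatrix hu x
  rw [EuclideanSpace.clm_apply_apply_eq_dotProduct]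
  change dotProduct _ ((hessianMatrix u x).mulVec _) = _
  rw [hA.mulVec_eigenvectorBasis, dotProduct_smul]
  have h := hA.eigenvectorBasis.inner_eq_ite j i
  rw [EuclideanSpace.inner_eq_star_dotProduct, star_trivial] at h
  rw [h, Matrix.diagonal_apply]
  by_cases hij : i = j
  · simp [hij]
  · simp [hij, Ne.symm hij]

/-- The derivative of the phase along a curve `x + t y`, in terms of the third derivative of `u`. -/
theorem fderiv_phase_apply (hu : ContDiff ℝ ∞ u) {x : EuclideanSpace ℝ (Fin n)}
    (hd : DifferentiableAt ℝ (phase hu) x) (y : EuclideanSpace ℝ (Fin n)) :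
    fderiv ℝ (phase hu) x y = ∑ i, (1 + (isHermitian_hessianMatrix hu x).eigenvalues i ^ 2)⁻¹ *
      fderiv ℝ (fderiv ℝ (fderiv ℝ u)) x y ((isHermitian_hessianMatrix hu x).eigenvectorBasis i)
        ((isHermitian_hessianMatrix hu x).eigenvectorBasis i) := by
  set b := (isHermitian_hessianMatrix hu x).eigenvectorBasis
  have hx : x + (0 : ℝ) • y = x := by simp
  have hT : HasDerivAt (fun t : ℝ => fderiv ℝ (fderiv ℝ u) (x + t • y))
      (fderiv ℝ (fderiv ℝ (fderiv ℝ u)) x y) 0 := by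
    have h := HasFDerivAt.hasDerivAt_add_smul (E := EuclideanSpace ℝ (Fin n))
      (F := EuclideanSpace ℝ (Fin n) →L[ℝ] EuclideanSpace ℝ (Fin n) →L[ℝ] ℝ)
      (hu.hasFDerivAt_fderiv_fderiv (x + (0 : ℝ) • y))
    rwa [hx] at h
  have hθ : HasDerivAt (fun t : ℝ => phase hu (x + t • y)) (fderiv ℝ (phase hu) x y) 0 :=
    HasFDerivAt.hasDerivAt_add_smul (E := EuclideanSpace ℝ (Fin n)) (hx.symm ▸ hd.hasFDerivAt)
  -- The eigenbasis at x is frozen along the line: the matrix is diagonal at t = 0, and its spectrum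
  -- is that of the Hessian for every t.
  refine deriv_sum_arctan_eigenvalues (t₀ := 0)
    (B := fun t => Matrix.of fun i j => fderiv ℝ (fderiv ℝ u) (x + t • y) (b i) (b j))
    (B' := Matrix.of fun i j => fderiv ℝ (fderiv ℝ (fderiv ℝ u)) x y (b i) (b j))
    (l := fun t => (isHermitian_hessianMatrix hu (x + t • y)).eigenvalues)
    (fun i j => ?_) (fun t => ?_) ?_ hθ
  · have h1 := hT.clm_apply (hasDerivAt_const (0 : ℝ) (b i))
    have h2 := h1.clm_apply (hasDerivAt_const (0 : ℝ) (b j))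
    refine h2.congr_deriv ?_
    simp
  · rw [charpoly_of_orthonormalBasis]
    exact (isHermitian_hessianMatrix hu (x + t • y)).charpoly_eq
  · ext i j
    simp only [hx, Matrix.of_apply]
    exact fderiv_fderiv_eigenvectorBasis hu x i j

/-- Local uniform ellipticity: eigenvalues are bounded by the operator norm of D²u, which is bounded
on compact balls. -/
theorem exists_eigenvalues_lower_bound (hu : ContDiff ℝ ∞ u) (R : ℝ) :
    ∃ δ > 0, ∀ x : EuclideanSpace ℝ (Fin n), ‖x‖ ≤ R →
      ∀ i, δ ≤ (1 + (isHermitian_hessianMatrix hu x).eigenvalues i ^ 2)⁻¹ := by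
  have hcont : Continuous (fderiv ℝ (fderiv ℝ u)) :=
    (hu.fderiv_right (m := ∞) (by norm_num)).continuous_fderiv (by norm_num)
  obtain ⟨M, hM⟩ := (isCompact_closedBall (0 : EuclideanSpace ℝ (Fin n)) R).exists_bound_of_continuousOn
    (f := fderiv ℝ (fderiv ℝ u)) hcont.continuousOn
  refine ⟨(1 + M ^ 2)⁻¹, by positivity, fun x hx i => ?_⟩
  set b := (isHermitian_hessianMatrix hu x).eigenvectorBasis
  have h1 := fderiv_fderiv_eigenvectorBasis hu x i i
  rw [Matrix.diagonal_apply_eq] at h1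
  have h2 := (fderiv ℝ (fderiv ℝ u) x).le_opNorm₂ (b i) (b i)
  rw [h1, b.norm_eq_one, mul_one, mul_one, Real.norm_eq_abs] at h2
  have h3 := sq_le_sq.2 ((h2.trans (hM x (by simpa using hx))).trans (le_abs_self M))
  gcongr

theorem phase_le (hu : ContDiff ℝ ∞ u) (x : EuclideanSpace ℝ (Fin n)) :
    phase hu x ≤ n * (Real.pi / 2) := by
  refine (Finset.sum_le_sum fun i _ => (Real.arctan_lt_pi_div_two _).le).trans ?_
  simp

end Hessian

/-! ### Rigidity of entire solutions. -/

theorem theorem1p2 (n : ℕ) (u : EuclideanSpace ℝ (Fin n) → ℝ) (hu : ContDiff ℝ ∞ u)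
    (hsol : ∀ x, phase hu x = (1 / 2) * inner ℝ x (gradient u x) - u x) :
    ∀ x, u x = u 0 + (1 / 2) * inner ℝ (Matrix.toEuclideanLin (hessianMatrix u 0) x) x := by
  have hphase : phase hu = fun x => (1 / 2) * fderiv ℝ u x x - u x := funext fun x => by
    rw [hsol x, real_inner_comm, inner_gradient_left]
  have hsmooth : ContDiff ℝ 2 (phase hu) := by
    rw [hphase]
    have h1 : ContDiff ℝ 2 (fderiv ℝ u) := (hu.fderiv_right (m := ∞) (by norm_num)).of_le two_le_contDiff_infty
    exact (contDiff_const.mul (h1.clm_apply contDiff_id)).sub (hu.of_le two_le_contDiff_infty)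
  have hconst := eq_of_driftOp_eq_zero hsmooth (phase_le hu)
    (b := fun x => (isHermitian_hessianMatrix hu x).eigenvectorBasis)
    (c := fun x i => (1 + (isHermitian_hessianMatrix hu x).eigenvalues i ^ 2)⁻¹)
    (exists_eigenvalues_lower_bound hu)
    (fun x i => inv_le_one_of_one_le₀ (le_add_of_nonneg_right (sq_nonneg _)))
    (fun x => by
      rw [driftOp, fderiv_phase_apply hu (hsmooth.differentiable (by norm_num) x), hphase,
        fderiv_fderiv_shrinkerPotential hu, sub_eq_zero, Finset.mul_sum]
      refine Finset.sum_congr rfl fun i _ => ?_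
      simp only [smul_apply, smul_eq_mul]
      ring)
  intro x
  rw [← fderiv_fderiv_apply_eq_inner]
  refine eq_quadratic_of_shrinkerPotential_const hu (c := phase hu 0) (fun y => ?_) x
  rw [← hconst y 0, hphase]
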